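/- Let $E$, $H$, $K$ be (real or complex) Hilbert spaces and let $A\colon E\to H$ and $B\colon E\to K$ be bounded linear operators. Notation and definitions. A linear relation from $H$ to $K$ is a linear subspace $T\subseteq H\times K$, with domain $\operatorname{dom}T=\{x:(x,y)\in T \text{ for some } y\}$ and range $\operatorname{ran}T=\{y:(x,y)\in T\text{ for some }x\}$. It is an operator if $(0,y)\in T$ implies $y=0$, and a bounded operator if moreover there is $c\ge 0$ with $\|y\|\le c\|x\|$ for all $(x,y)\in T$. It is regular if its closure is an operator, and singular if its closure is $M\times N$ for some closed linear subspaces $M\subseteq H$, $N\subseteq K$. Its adjoint is $T^*=\{(h,k)\in K\times H:\langle g,h\rangle=\langle f,k\rangle\text{ for all }(f,g)\in T\}$. A Lebesgue type decomposition of $T$ is a pair of linear relations $T_1,T_2$ from $H$ to $K$ with $\operatorname{dom}T_1=\operatorname{dom}T_2=\operatorname{dom}T$, $T=T_1+T_2:=\{(x,y_1+y_2):(x,y_1)\in T_1,\ (x,y_2)\in T_2\}$, $\operatorname{ran}T_1\perp\operatorname{ran}T_2$, $T_1$ regular and $T_2$ singular. Let $C\colon E\to G$ and $C'\colon E\to G'$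 be bounded linear operators into Hilbert spaces. $C$ is dominated by $C'$ if there is $c>0$ with $\|Cf\|\le c\|C'f\|$ for all $f\in E$. $C$ is almost dominated by $C'$ if there are Hilbert spaces $K_n$, bounded operators $C_n\colon E\to K_n$ and constants $c_n\ge0$ such that for all $f\in E$ and $n$: $\|C_nf\|\le c_n\|C'f\|$, $\|C_nf\|\le\|C_{n+1}f\|$, and $\|C_nf\|\to\|Cf\|$ as $n\to\infty$. $C$ is singular with respect to $C'$ if the only bounded operator $D\colon E\to E$ that is dominated by both $C$ and $C'$ is $D=0$. A Lebesgue type decomposition of $B$ with respect to $A$ is a pair of bounded operators $B_1,B_2\colon E\to K$ with $B=B_1+B_2$, $\operatorname{ran}B_1\perp\operatorname{ran}B_2$, $B_1$ almost dominated by $A$, and $B_2$ singular with respect to $A$. Put $L(A,B)=\{(Af,Bf):f\in E\}$, a linear relation from $H$ to $K$, and $\mathfrak D(A,B)=\{k\in K:B^*k\in\operatorname{ran}A^*\}$. Let $P$ be the orthogonal projection of $K$ onto $\mathfrak D(A,B)^\perp$, and put $B_{\rm reg}=(I-P)B$ and $B_{\rm sing}=PB$. The Radon–Nikodym derivative of $B_{\rm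 reg}$ with respect to $A$ is $R(A,B_{\rm reg})=L(A,B_{\rm reg})^{**}$. Then the following statements are equivalent: (i) $B$ admits a unique Lebesgue type decomposition with respect to $A$; (ii) $L(A,B)$ admits a unique Lebesgue type decomposition; (iii) $\mathfrak D(A,B)$ is closed; (iv) $B_{\rm reg}$ is dominated by $A$; (v) the Radon–Nikodym derivative $R(A,B_{\rm reg})$ is a bounded operator. In this case, the only Lebesgue type decomposition of $B$ with respect to $A$ is $B=B_{\rm reg}+B_{\rm sing}$. -/

import Mathlib

universe u v w

namespace LebesgueType

section Relations

variable {𝕜 : Type*} [RCLike 𝕜]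
  {H : Type*} [NormedAddCommGroup H] [InnerProductSpace 𝕜 H]
  {K : Type*} [NormedAddCommGroup K] [InnerProductSpace 𝕜 K]

/-- A linear relation from `H` to `K` is a linear subspace of `H × K`. -/
abbrev Relation (𝕜 : Type*) [RCLike 𝕜]
    (H : Type*) [NormedAddCommGroup H] [InnerProductSpace 𝕜 H]
    (K : Type*) [NormedAddCommGroup K] [InnerProductSpace 𝕜 K] : Type _ :=
  Submodule 𝕜 (H × K)

/-- The domain of a linear relation. -/
def Relation.dom (T : Relation 𝕜 H K) : Submodule 𝕜 H :=
  Submodule.map (LinearMap.fst 𝕜 H K) T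

/-- The range of a linear relation. -/
def Relation.ran (T : Relation 𝕜 H K) : Submodule 𝕜 K :=
  Submodule.map (LinearMap.snd 𝕜 H K) T

/-- A linear relation is (the graph of) an operator if its multivalued part is trivial. -/
def Relation.IsOperator (T : Relation 𝕜 H K) : Prop :=
  ∀ y : K, ((0 : H), y) ∈ T → y = 0

/-- A linear relation is a bounded operator (defined on its domain). -/
def Relation.IsBoundedOperator (T : Relation 𝕜 H K) : Prop :=
  Relation.IsOperator T ∧ ∃ c : ℝ, ∀ x y, (x, y) ∈ T → ‖y‖ ≤ c * ‖x‖

/-- The (operatorwise) sum of linear relations: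
`T₁ + T₂ = {(x, y₁ + y₂) : (x, y₁) ∈ T₁, (x, y₂) ∈ T₂}`. -/
def Relation.sum (T₁ T₂ : Relation 𝕜 H K) : Relation 𝕜 H K where
  carrier := {p | ∃ y₁ y₂ : K, (p.1, y₁) ∈ T₁ ∧ (p.1, y₂) ∈ T₂ ∧ p.2 = y₁ + y₂}
  add_mem' := by
    rintro p q ⟨y₁, y₂, h₁, h₂, h⟩ ⟨z₁, z₂, k₁, k₂, k⟩
    refine ⟨y₁ + z₁, y₂ + z₂, T₁.add_mem h₁ k₁, T₂.add_mem h₂ k₂, ?_⟩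
    rw [Prod.snd_add, h, k]
    abel
  zero_mem' := ⟨0, 0, T₁.zero_mem, T₂.zero_mem, by simp⟩
  smul_mem' := by
    rintro c p ⟨y₁, y₂, h₁, h₂, h⟩
    refine ⟨c • y₁, c • y₂, T₁.smul_mem c h₁, T₂.smul_mem c h₂, ?_⟩
    rw [Prod.smul_snd, h, smul_add]

/-- A linear relation is regular if its closure is an operator, i.e. it is a closable operator. -/
def Relation.IsRegular (T : Relation 𝕜 H K) : Prop :=
  Relation.IsOperator (Submodule.topologicalClosure T)

/-- A linear relation is singular if its closure is the product of closed linear subspaces. -/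
def Relation.IsSingular (T : Relation 𝕜 H K) : Prop :=
  ∃ (M : Submodule 𝕜 H) (N : Submodule 𝕜 K), IsClosed (M : Set H) ∧ IsClosed (N : Set K) ∧
    Submodule.topologicalClosure T = Submodule.prod M N

/-- `T = T₁ + T₂` is a Lebesgue type decomposition of the linear relation `T`: the components have
the same domain as `T` and orthogonal ranges, `T₁` is regular, and `T₂` is singular. -/
structure Relation.IsLebesgueTypeDecomposition (T T₁ T₂ : Relation 𝕜 H K) : Prop where
  eq_sum : T = Relation.sum T₁ T₂
  dom_left : Relation.dom T₁ = Relation.dom T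
  dom_right : Relation.dom T₂ = Relation.dom T
  ran_ortho : Submodule.IsOrtho (Relation.ran T₁) (Relation.ran T₂)
  regular : Relation.IsRegular T₁
  singular : Relation.IsSingular T₂

end Relations

section Pairs

variable {𝕜 : Type*} [RCLike 𝕜]
  {E : Type u} [NormedAddCommGroup E] [InnerProductSpace 𝕜 E]
  {H : Type v} [NormedAddCommGroup H] [InnerProductSpace 𝕜 H]
  {K : Type w} [NormedAddCommGroup K] [InnerProductSpace 𝕜 K]

/-- The linear relation `L(A,B) = {(Af, Bf) : f ∈ E}` from `H` to `K`. -/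
def L (A : E →L[𝕜] H) (B : E →L[𝕜] K) : Relation 𝕜 H K :=
  LinearMap.range (A.prod B : E →ₗ[𝕜] H × K)

/-- `B` is dominated by `A`. -/
def Dominated (A : E →L[𝕜] H) (B : E →L[𝕜] K) : Prop :=
  ∃ c : ℝ, 0 < c ∧ ∀ f : E, ‖B f‖ ≤ c * ‖A f‖

/-- `B` is almost dominated by `A`: there are Hilbert spaces `Kₙ`, bounded operators
`Bₙ : E → Kₙ` and constants `cₙ ≥ 0` with `‖Bₙ f‖ ≤ cₙ ‖A f‖` and `‖Bₙ f‖ ↗ ‖B f‖` for all `f`.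
(Only the norms `‖Bₙ f‖` matter, and `Kₙ` may always be replaced by the closure of the range of
`Bₙ`, which is isometric to a closed subspace of `E`; so the universe of the `Kₙ` is no
restriction.) -/
def AlmostDominated (A : E →L[𝕜] H) (B : E →L[𝕜] K) : Prop :=
  ∃ (Kn : ℕ → Type (max u v w)) (_ : ∀ n, NormedAddCommGroup (Kn n))
    (_ : ∀ n, InnerProductSpace 𝕜 (Kn n)) (_ : ∀ n, CompleteSpace (Kn n))
    (Bn : ∀ n, E →L[𝕜] Kn n) (c : ℕ → ℝ),
    (∀ n, 0 ≤ c n) ∧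
    (∀ f n, ‖Bn n f‖ ≤ c n * ‖A f‖) ∧
    (∀ f n, ‖Bn n f‖ ≤ ‖Bn (n + 1) f‖) ∧
    (∀ f, Filter.Tendsto (fun n => ‖Bn n f‖) Filter.atTop (nhds ‖B f‖))

/-- `B` is singular with respect to `A`: the only bounded operator on `E` that is dominated both by
`A` and by `B` is `0`. -/
def Singular (A : E →L[𝕜] H) (B : E →L[𝕜] K) : Prop :=
  ∀ D : E →L[𝕜] E, Dominated A D → Dominated B D → D = 0

/-- `B = B₁ + B₂` is a Lebesgue type decomposition of `B` with respect to `A`. -/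
structure IsLebesgueTypeDecomposition (A : E →L[𝕜] H) (B B₁ B₂ : E →L[𝕜] K) : Prop where
  eq_add : B = B₁ + B₂
  ran_ortho : Submodule.IsOrtho (LinearMap.range (B₁ : E →ₗ[𝕜] K))
    (LinearMap.range (B₂ : E →ₗ[𝕜] K))
  almostDominated : AlmostDominated A B₁
  singular : Singular A B₂

variable [CompleteSpace E] [CompleteSpace H] [CompleteSpace K]

/-- The subspace `𝔇(A,B) = {k ∈ K : B* k ∈ ran A*}` of `K`. -/
noncomputable def DD (A : E →L[𝕜] H) (B : E →L[𝕜] K) : Submodule 𝕜 K :=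
  Submodule.comap (ContinuousLinearMap.adjoint B : K →ₗ[𝕜] E)
    (LinearMap.range (ContinuousLinearMap.adjoint A : H →ₗ[𝕜] E))

/-- The singular part `B_sing = P B`, with `P` the orthogonal projection onto `𝔇(A,B)ᗮ`. -/
noncomputable def singPart (A : E →L[𝕜] H) (B : E →L[𝕜] K) : E →L[𝕜] K :=
  ((DD A B)ᗮ.starProjection).comp B

/-- The regular part `B_reg = (I - P) B`, with `P` the orthogonal projection onto `𝔇(A,B)ᗮ`. -/
noncomputable def regPart (A : E →L[𝕜] H) (B : E →L[𝕜] K) : E →L[𝕜] K :=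
  (ContinuousLinearMap.id 𝕜 K - (DD A B)ᗮ.starProjection).comp B

/-- The Radon-Nikodym derivative `R(A,B) = L(A,B)**` of `B` with respect to `A` (used for `B` almost
dominated by `A`), as a linear relation, with Mathlib's adjoint
`T* = {(h, k) : ⟪g, h⟫ = ⟪f, k⟫ for all (f, g) ∈ T}` of linear relations. -/
noncomputable def radonNikodym (A : E →L[𝕜] H) (B : E →L[𝕜] K) : Relation 𝕜 H K :=
  Submodule.adjoint (Submodule.adjoint (L A B))

end Pairs

end LebesgueType

/-!
Everything is governed by the relation `{(k, h) : C* k = A* h}`, which is the adjoint of `L(A,C)`.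
As the closure of a relation is its double adjoint, the multivalued part of the closure of `L(A,C)`
is `𝔇(A,C)ᗮ`. Hence `L(A,C)` is regular if and only if `𝔇(A,C)` is dense (`isRegular_L_iff`), and
it is singular if and only if `ran A* ∩ ran C* = 0` (`isSingular_L_iff`). The notions for pairs of
operators reduce to the same two conditions. Singularity does so by Riesz representation and rank
one operators (`singular_iff`). Almost domination implies regularity because approximants dominated
by `A` and increasing to `C` force `C fⱼ → 0` whenever `A fⱼ → 0` and `C fⱼ` converges; conversely,
if `𝔇(A,C)` is dense, the square roots of the parallel sums of the forms `n² ‖A ·‖²` and `‖C ·‖²`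
are dominated by `A` and increase to `C` (`almostDominated_iff`).

The decompositions of `L(A,B)` therefore correspond bijectively to those of `B`
(`relation_isLebesgueTypeDecomposition_L_iff`). The pair `B_reg`, `B_sing` is always a
decomposition. If `𝔇(A,B)` is closed, it is the only one (`eq_singPart_of_isClosed`). If `𝔇(A,B)`
is not closed, projecting onto the sum of `𝔇(A,B)ᗮ` and the line through a vector of the closure of
`𝔇(A,B)` outside `𝔇(A,B)` gives another one (`isClosed_of_existsUnique`). Finally `𝔇(A,B)` is closed
if and only if `ran B_reg* ⊆ ran A*`, which by Douglas' lemma means that `A` dominates `B_reg`; and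
domination passes to the closure of `L(A,B_reg)`, its Radon-Nikodym derivative.
-/

namespace LebesgueType

open ContinuousLinearMap Filter Topology
open scoped InnerProduct

/-! ### The double adjoint of a linear relation -/

section Relations

variable {𝕜 : Type*} [RCLike 𝕜]
  {H : Type*} [NormedAddCommGroup H] [InnerProductSpace 𝕜 H] [CompleteSpace H]
  {K : Type*} [NormedAddCommGroup K] [InnerProductSpace 𝕜 K] [CompleteSpace K]

/-- In Hilbert spaces `T** = T⁻`: up to the unitary `(x, y) ↦ (y, -x)`, the adjoint is the
orthogonal complement. -/
theorem Relation.adjoint_adjoint (T : Relation 𝕜 H K) :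
    Submodule.adjoint (Submodule.adjoint T) = Submodule.topologicalClosure T := by
  apply le_antisymm
  · rintro ⟨x, y⟩ hp
    rw [Submodule.mem_adjoint_iff] at hp
    let e := WithLp.prodContinuousLinearEquiv 2 𝕜 H K
    let S : Submodule 𝕜 (WithLp 2 (H × K)) := T.map (e.symm : H × K →ₗ[𝕜] WithLp 2 (H × K))
    have h1 : e.symm (x, y) ∈ Sᗮᗮ := by
      rw [Submodule.mem_orthogonal]
      intro w hw
      have h2 := hp w.snd (-w.fst) (by
        rw [Submodule.mem_adjoint_iff]
        intro a b hab
        have := (Submodule.mem_orthogonal _ _).1 hw (e.symm (a, b))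
          (Submodule.mem_map_of_mem hab)
        rw [WithLp.prod_inner_apply] at this
        have h3 : inner 𝕜 a w.fst + inner 𝕜 b w.snd = 0 := this
        dsimp only
        rw [inner_neg_right, sub_neg_eq_add, add_comm, h3])
      rw [WithLp.prod_inner_apply]
      change inner 𝕜 w.fst x + inner 𝕜 w.snd y = 0
      dsimp only at h2
      rw [inner_neg_left] at h2
      linear_combination -h2
    rw [Submodule.orthogonal_orthogonal_eq_closure] at h1
    have h4 : e (e.symm (x, y)) ∈ closure (T : Set (H × K)) := by
      refine map_mem_closure e.continuous h1 ?_
      rintro _ ⟨p, hp, rfl⟩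
      simpa using hp
    rw [e.apply_symm_apply] at h4
    exact h4
  · apply Submodule.topologicalClosure_minimal
    · rintro ⟨x, y⟩ hp
      rw [Submodule.mem_adjoint_iff]
      intro a b hab
      have := (Submodule.mem_adjoint_iff _ _).1 hab x y hp
      dsimp only at this ⊢
      rw [← inner_conj_symm, ← inner_conj_symm a, ← map_sub, ← neg_sub, this]
      simp
    · have : ((Submodule.adjoint (Submodule.adjoint T) : Submodule 𝕜 (H × K)) : Set (H × K)) =
          ⋂ q ∈ Submodule.adjoint T, {p : H × K | inner 𝕜 q.2 p.1 - inner 𝕜 q.1 p.2 = 0} := by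
        ext p
        simp only [SetLike.mem_coe, Submodule.mem_adjoint_iff _ p, Set.mem_iInter,
          Set.mem_ofPred_eq, Prod.forall]
      rw [this]
      refine isClosed_biInter fun q _ => isClosed_eq ?_ continuous_const
      fun_prop

end Relations

/-! ### The relation `L(A,C)`, domination and singularity -/

section Pairs

variable {𝕜 : Type*} [RCLike 𝕜]
  {E : Type u} [NormedAddCommGroup E] [InnerProductSpace 𝕜 E]
  {H : Type v} [NormedAddCommGroup H] [InnerProductSpace 𝕜 H]
  {K : Type w} [NormedAddCommGroup K] [InnerProductSpace 𝕜 K]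

theorem mem_L {A : E →L[𝕜] H} {B : E →L[𝕜] K} {x : H} {y : K} :
    (x, y) ∈ L A B ↔ ∃ f, A f = x ∧ B f = y := by
  simp [L, LinearMap.mem_range]

theorem mem_dom_L {A : E →L[𝕜] H} {B : E →L[𝕜] K} {x : H} :
    x ∈ Relation.dom (L A B) ↔ ∃ f, A f = x := by
  simp [Relation.dom, mem_L]

theorem mem_ran_L {A : E →L[𝕜] H} {B : E →L[𝕜] K} {y : K} :
    y ∈ Relation.ran (L A B) ↔ ∃ f, B f = y := by
  simp [Relation.ran, mem_L]

theorem mk_mem_L (A : E →L[𝕜] H) (B : E →L[𝕜] K) (f : E) : (A f, B f) ∈ L A B :=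
  mem_L.2 ⟨f, rfl, rfl⟩

variable [CompleteSpace H] [CompleteSpace K]

theorem dominated_iff_isBoundedOperator_radonNikodym {A : E →L[𝕜] H} {C : E →L[𝕜] K} :
    Dominated A C ↔ Relation.IsBoundedOperator (radonNikodym A C) := by
  rw [radonNikodym, Relation.adjoint_adjoint]
  constructor
  · rintro ⟨c, -, hc⟩
    have hcl : IsClosed {p : H × K | ‖p.2‖ ≤ c * ‖p.1‖} := isClosed_le (by fun_prop) (by fun_prop)
    have hle : ∀ x y, (x, y) ∈ Submodule.topologicalClosure (L A C) → ‖y‖ ≤ c * ‖x‖ := by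
      intro x y hxy
      refine closure_minimal (fun p hp => ?_) hcl hxy
      obtain ⟨f, h1, h2⟩ := mem_L.1 (show (p.1, p.2) ∈ L A C from hp)
      rw [Set.mem_ofPred_eq, ← h1, ← h2]
      exact hc f
    exact ⟨fun y hy => by simpa using hle 0 y hy, c, hle⟩
  · rintro ⟨-, c, hc⟩
    refine ⟨|c| + 1, by positivity, fun f => ?_⟩
    refine (hc _ _ (Submodule.le_topologicalClosure _ (mk_mem_L A C f))).trans ?_
    gcongr
    linarith [le_abs_self c]

variable [CompleteSpace E]

theorem mem_DD {A : E →L[𝕜] H} {B : E →L[𝕜] K} {k : K} :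
    k ∈ DD A B ↔ ∃ h, (A†) h = (B†) k := by
  simp [DD]

/-- The closure of `L(A,C)` is the annihilator of its adjoint `{(k, h) : C* k = A* h}`. -/
theorem mem_closure_L_iff {A : E →L[𝕜] H} {C : E →L[𝕜] K} {x : H} {y : K} :
    (x, y) ∈ Submodule.topologicalClosure (L A C) ↔
      ∀ h k, (A†) h = (C†) k → inner 𝕜 k y = inner 𝕜 h x := by
  rw [← Relation.adjoint_adjoint, Submodule.mem_adjoint_iff]
  have key : ∀ k h, (k, h) ∈ Submodule.adjoint (L A C) ↔ (A†) h = (C†) k := by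
    intro k h
    rw [Submodule.mem_adjoint_iff]
    constructor
    · intro H0
      refine ext_inner_left 𝕜 fun f => ?_
      have := H0 _ _ (mk_mem_L A C f)
      rw [adjoint_inner_right, adjoint_inner_right]
      exact (sub_eq_zero.1 this).symm
    · intro e a b hab
      obtain ⟨f, rfl, rfl⟩ := mem_L.1 hab
      dsimp only
      rw [← adjoint_inner_right, ← adjoint_inner_right, e, sub_self]
  constructor
  · intro h0 h k e
    exact (sub_eq_zero.1 (h0 k h ((key k h).2 e))).symm
  · intro h0 k h e
    exact sub_eq_zero.2 (h0 h k ((key k h).1 e)).symm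

/-- The multivalued part of the closure of `L(A,C)` is `𝔇(A,C)ᗮ`; so regularity is density of
`𝔇(A,C)`. -/
theorem isRegular_L_iff {A : E →L[𝕜] H} {C : E →L[𝕜] K} :
    Relation.IsRegular (L A C) ↔ (DD A C)ᗮ = ⊥ := by
  have key : ∀ y : K, ((0 : H), y) ∈ Submodule.topologicalClosure (L A C) ↔ y ∈ (DD A C)ᗮ := by
    intro y
    rw [mem_closure_L_iff, Submodule.mem_orthogonal]
    constructor
    · intro h0 k hk
      obtain ⟨h, e⟩ := mem_DD.1 hk
      simpa using h0 h k e
    · intro h0 h k e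
      simpa using h0 k (mem_DD.2 ⟨h, e⟩)
  rw [Submodule.eq_bot_iff]
  exact forall_congr' fun y => by rw [key]

/-- `L(A,C)` is singular if and only if `ran A*` and `ran C*` meet trivially. -/
theorem isSingular_L_iff {A : E →L[𝕜] H} {C : E →L[𝕜] K} :
    Relation.IsSingular (L A C) ↔ ∀ h k, (A†) h = (C†) k → (C†) k = 0 := by
  constructor
  · rintro ⟨M, N, -, -, hMN⟩ h k e
    refine ext_inner_right 𝕜 fun f => ?_
    have h1 : (A f, C f) ∈ Submodule.topologicalClosure (L A C) :=
      Submodule.le_topologicalClosure _ (mk_mem_L A C f)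
    rw [hMN] at h1
    have h2 : ((0 : H), C f) ∈ Submodule.topologicalClosure (L A C) := by
      rw [hMN]
      exact ⟨M.zero_mem, h1.2⟩
    rw [adjoint_inner_left, mem_closure_L_iff.1 h2 h k e]
    simp
  · intro h0
    refine ⟨(LinearMap.ker (A† : H →ₗ[𝕜] E))ᗮ, (LinearMap.ker (C† : K →ₗ[𝕜] E))ᗮ,
      Submodule.isClosed_orthogonal _, Submodule.isClosed_orthogonal _, ?_⟩
    ext ⟨x, y⟩
    rw [mem_closure_L_iff, Submodule.mem_prod, Submodule.mem_orthogonal, Submodule.mem_orthogonal]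
    constructor
    · intro h1
      constructor
      · intro h hh
        have hh' : (A†) h = 0 := hh
        simpa using (h1 h 0 (by simpa using hh')).symm
      · intro k hk
        have hk' : (C†) k = 0 := hk
        simpa using h1 0 k (by simpa using hk'.symm)
    · rintro ⟨hx, hy⟩ h k e
      have hk := h0 h k e
      rw [hy k hk, hx h (e.trans hk)]

/-- By the Riesz representation theorem, `ran A*` consists of the vectors whose functional is
bounded by a multiple of `‖A ·‖`. -/
theorem exists_adjoint_eq_of_norm_inner_le {A : E →L[𝕜] H} {e : E} {c : ℝ}
    (h : ∀ f, ‖inner 𝕜 e f‖ ≤ c * ‖A f‖) : ∃ g, (A†) g = e := by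
  -- A linear section of `A` turns `⟪e, ·⟫` into a bounded functional on `ran A`.
  obtain ⟨s, hs⟩ := LinearMap.exists_rightInverse_of_surjective
    (A : E →ₗ[𝕜] H).rangeRestrict (LinearMap.range_rangeRestrict _)
  have hs' : ∀ x, A (s x) = x := fun x => congrArg Subtype.val (LinearMap.congr_fun hs x)
  let φ : LinearMap.range (A : E →ₗ[𝕜] H) →L[𝕜] 𝕜 :=
    LinearMap.mkContinuous ((innerSL 𝕜 e : E →ₗ[𝕜] 𝕜) ∘ₗ s) c (fun x => by
      have := h (s x)
      rw [hs'] at this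
      exact this)
  obtain ⟨g, hg, -⟩ := exists_extension_norm_eq _ φ
  refine ⟨(InnerProductSpace.toDual 𝕜 H).symm g, ext_inner_right 𝕜 fun f => ?_⟩
  rw [adjoint_inner_left, InnerProductSpace.toDual_symm_apply]
  have h1 : g (A f) = inner 𝕜 e (s ⟨A f, f, rfl⟩) := hg ⟨A f, f, rfl⟩
  rw [h1, ← sub_eq_zero, ← inner_sub_right, ← norm_le_zero_iff]
  refine (h _).trans ?_
  rw [map_sub, hs', sub_self, norm_zero, mul_zero]

theorem Dominated.exists_adjoint_eq {A : E →L[𝕜] H} {C : E →L[𝕜] K} (h : Dominated A C) (k : K) :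
    ∃ g, (A†) g = (C†) k := by
  obtain ⟨c, -, hc⟩ := h
  refine exists_adjoint_eq_of_norm_inner_le (c := ‖k‖ * c) fun f => ?_
  rw [adjoint_inner_left, mul_assoc]
  exact (norm_inner_le_norm _ _).trans (by gcongr; exact hc f)

/-- Douglas' lemma: `C` is dominated by `A` as soon as `ran C* ⊆ ran A*`. -/
theorem dominated_of_forall_exists_adjoint_eq {A : E →L[𝕜] H} {C : E →L[𝕜] K}
    (h : ∀ k, ∃ g, (A†) g = (C†) k) : Dominated A C := by
  -- The vectors `C f` with `‖A f‖ ≤ 1` are weakly bounded, hence bounded.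
  obtain ⟨c, hc⟩ := banach_steinhaus (ι := {f : E // ‖A f‖ ≤ 1})
    (g := fun f => innerSL 𝕜 (C f.1)) (fun k => by
      obtain ⟨g, hg⟩ := h k
      refine ⟨‖g‖, fun f => ?_⟩
      rw [innerSL_apply_apply, ← adjoint_inner_right, ← hg, adjoint_inner_right]
      refine (norm_inner_le_norm _ _).trans ?_
      exact mul_le_of_le_one_left (norm_nonneg _) f.2)
  have hc' : ∀ f, ‖A f‖ ≤ 1 → ‖C f‖ ≤ c := fun f hf => by
    simpa using hc ⟨f, hf⟩
  have hc0 : 0 ≤ c := by simpa using hc' 0 (by simp)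
  refine ⟨c + 1, by positivity, fun f => ?_⟩
  -- Scaling by `a > 0` rather than by `‖A f‖` covers the case `A f = 0`.
  have hmul : ∀ a : ℝ, 0 < a → ‖A f‖ ≤ a → ‖C f‖ ≤ c * a := fun a ha hfa => by
    have := hc' (((a⁻¹ : ℝ) : 𝕜) • f) (by
      rw [map_smul, norm_smul, RCLike.norm_ofReal, abs_of_pos (inv_pos.2 ha)]
      rw [inv_mul_le_iff₀ ha, mul_one]
      exact hfa)
    rw [map_smul, norm_smul, RCLike.norm_ofReal, abs_of_pos (inv_pos.2 ha),
      inv_mul_le_iff₀ ha] at this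
    linarith
  have h1 : ‖C f‖ ≤ c * ‖A f‖ := by
    refine le_of_forall_pos_le_add fun ε hε => ?_
    have := hmul (‖A f‖ + ε / (c + 1)) (by positivity) (by
      have : 0 < ε / (c + 1) := by positivity
      linarith)
    have h2 : c * (ε / (c + 1)) ≤ ε := by
      rw [mul_div_assoc', div_le_iff₀ (by positivity)]
      nlinarith
    linarith [mul_add c ‖A f‖ (ε / (c + 1))]
  nlinarith [norm_nonneg (A f)]

/-- Vectors of `ran A*` give rank one operators dominated by `A`. -/
theorem dominated_rankOne {A : E →L[𝕜] H} {z : E} {g : H} (hg : (A†) g = z) :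
    Dominated A ((innerSL 𝕜 z).smulRight z) := by
  refine ⟨‖g‖ * ‖z‖ + 1, by positivity, fun f => ?_⟩
  have h1 : ‖inner 𝕜 z f‖ ≤ ‖g‖ * ‖A f‖ := by
    rw [← hg, adjoint_inner_left]
    exact norm_inner_le_norm _ _
  rw [smulRight_apply, innerSL_apply_apply, norm_smul]
  have := mul_le_mul_of_nonneg_right h1 (norm_nonneg z)
  nlinarith [norm_nonneg (A f)]

/-- `C` is singular with respect to `A` if and only if `ran A*` and `ran C*` meet trivially: the
range of `D*` lies in both when `D` is dominated by both, and conversely a nonzero common vector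
gives a nonzero rank one operator. -/
theorem singular_iff {A : E →L[𝕜] H} {C : E →L[𝕜] K} :
    Singular A C ↔ ∀ h k, (A†) h = (C†) k → (C†) k = 0 := by
  constructor
  · intro h0 h k e
    set z := (C†) k with hz
    have h1 := h0 _ (dominated_rankOne e) (dominated_rankOne rfl)
    have h2 := DFunLike.congr_fun h1 z
    simpa using h2
  · intro h0 D hA hC
    have : D† = 0 := by
      ext g
      obtain ⟨h, e1⟩ := hA.exists_adjoint_eq g
      obtain ⟨k, e2⟩ := hC.exists_adjoint_eq g
      rw [← e2, h0 h k (e1.trans e2.symm)]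
      rfl
    rw [← ContinuousLinearMap.adjoint_adjoint D, this, map_zero]

end Pairs

/-! ### Almost domination and regular relations -/

section AlmostDomination

variable {𝕜 : Type*} [RCLike 𝕜]
  {E : Type u} [NormedAddCommGroup E] [InnerProductSpace 𝕜 E]
  {H : Type v} [NormedAddCommGroup H] [InnerProductSpace 𝕜 H]
  {K : Type w} [NormedAddCommGroup K] [InnerProductSpace 𝕜 K]

theorem AlmostDominated.isRegular_L {A : E →L[𝕜] H} {C : E →L[𝕜] K} (h : AlmostDominated A C) :
    Relation.IsRegular (L A C) := by
  obtain ⟨Kn, _, _, _, Cn, c, hc, hle, hmono, hlim⟩ := h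
  intro y hy
  obtain ⟨p, hp, hpt⟩ := mem_closure_iff_seq_limit.1 hy
  choose f hf using fun j => mem_L.1 (show ((p j).1, (p j).2) ∈ L A C from hp j)
  have hA : Tendsto (fun j => A (f j)) atTop (𝓝 0) := by
    simp only [(hf _).1]
    exact (continuous_fst.tendsto _).comp hpt
  have hC : Tendsto (fun j => C (f j)) atTop (𝓝 y) := by
    simp only [(hf _).2]
    exact (continuous_snd.tendsto _).comp hpt
  have hCn : ∀ n, Tendsto (fun j => ‖Cn n (f j)‖) atTop (𝓝 0) := fun n => by
    refine squeeze_zero (fun _ => norm_nonneg _) (fun j => hle (f j) n) ?_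
    simpa using (hA.norm.const_mul (c n))
  have hCnC : ∀ n g, ‖Cn n g‖ ≤ ‖C g‖ := fun n g =>
    (monotone_nat_of_le_succ (hmono g)).ge_of_tendsto (hlim g) n
  have h0 : Tendsto (fun j => C (f j)) atTop (𝓝 0) := by
    rw [NormedAddCommGroup.tendsto_atTop']
    intro ε hε
    obtain ⟨N, hN⟩ := Metric.cauchySeq_iff.1 hC.cauchySeq (ε / 2) (half_pos hε)
    refine ⟨N, fun j hj => ?_⟩
    rw [sub_zero]
    refine lt_of_le_of_lt ?_ (half_lt_self hε)
    refine le_of_tendsto' (hlim (f j)) fun n => ?_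
    -- `‖Cₙ fⱼ‖ ≤ ‖C (fⱼ - fᵢ)‖ + ‖Cₙ fᵢ‖`, where the last term vanishes as `i → ∞`.
    have h1 : Tendsto (fun i => ε / 2 + ‖Cn n (f i)‖) atTop (𝓝 (ε / 2)) := by
      simpa using (hCn n).const_add (ε / 2)
    refine ge_of_tendsto h1 ?_
    filter_upwards [eventually_ge_atTop N] with i hi
    have h2 : ‖Cn n (f j - f i)‖ < ε / 2 := by
      refine (hCnC n _).trans_lt ?_
      rw [map_sub, ← dist_eq_norm]
      exact hN j (le_of_lt hj) i hi
    calc ‖Cn n (f j)‖ = ‖Cn n (f j - f i) + Cn n (f i)‖ := by rw [map_sub, sub_add_cancel]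
      _ ≤ ‖Cn n (f j - f i)‖ + ‖Cn n (f i)‖ := norm_add_le _ _
      _ ≤ _ := by gcongr
  exact tendsto_nhds_unique hC h0

/-- The operator `f ↦ (t A f, C f)` into the Hilbert space sum of `H` and `K`. -/
noncomputable def weightedGraph (A : E →L[𝕜] H) (C : E →L[𝕜] K) (t : ℝ) :
    E →L[𝕜] WithLp 2 (H × K) :=
  ((WithLp.prodContinuousLinearEquiv 2 𝕜 H K).symm : H × K →L[𝕜] WithLp 2 (H × K)) ∘L
    (((t : 𝕜) • A).prod C)

theorem inner_weightedGraph (A : E →L[𝕜] H) (C : E →L[𝕜] K) (t : ℝ) (f : E)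
    (w : WithLp 2 (H × K)) :
    inner 𝕜 (weightedGraph A C t f) w = t * inner 𝕜 (A f) w.fst + inner 𝕜 (C f) w.snd := by
  rw [WithLp.prod_inner_apply]
  change inner 𝕜 ((t : 𝕜) • A f) w.fst + inner 𝕜 (C f) w.snd = _
  rw [inner_smul_left, RCLike.conj_ofReal]

theorem mem_orthogonal_range_weightedGraph {A : E →L[𝕜] H} {C : E →L[𝕜] K} {t : ℝ}
    {w : WithLp 2 (H × K)} :
    w ∈ (LinearMap.range (weightedGraph A C t : E →ₗ[𝕜] WithLp 2 (H × K)))ᗮ ↔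
      ∀ f, (t : 𝕜) * inner 𝕜 (A f) w.fst + inner 𝕜 (C f) w.snd = 0 := by
  rw [Submodule.mem_orthogonal]
  constructor
  · intro h f
    rw [← inner_weightedGraph]
    exact h _ ⟨f, rfl⟩
  · rintro h _ ⟨f, rfl⟩
    exact (inner_weightedGraph A C t f w).trans (h f)

theorem norm_snd_le (w : WithLp 2 (H × K)) : ‖w.snd‖ ≤ ‖w‖ := by
  have := WithLp.prod_norm_sq_eq_of_L2 w
  refine (pow_le_pow_iff_left₀ (norm_nonneg _) (norm_nonneg _) two_ne_zero).1 ?_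
  nlinarith [sq_nonneg ‖w.fst‖]

variable [CompleteSpace H] [CompleteSpace K]

/-- The square root of the parallel sum of the forms `t² ‖A f‖²` and `‖C f‖²`: the square of
`‖parallelSum A C t f‖` is the infimum over `g` of `t² ‖A (f - g)‖² + ‖C g‖²`, that is, the squared
distance of `(t A f, 0)` to the vectors `(t A g, C g)`. -/
noncomputable def parallelSum (A : E →L[𝕜] H) (C : E →L[𝕜] K) (t : ℝ) :
    E →L[𝕜] WithLp 2 (H × K) :=
  (LinearMap.range (weightedGraph A C t : E →ₗ[𝕜] WithLp 2 (H × K)))ᗮ.starProjection ∘L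
    weightedGraph A 0 t

/-- `parallelSum A C t f` is orthogonal to the vectors `(t A g, C g)`. -/
theorem inner_weightedGraph_parallelSum_eq_zero (A : E →L[𝕜] H) (C : E →L[𝕜] K)
    (t : ℝ) (f g : E) :
    (t : 𝕜) * inner 𝕜 (A g) (parallelSum A C t f).fst +
      inner 𝕜 (C g) (parallelSum A C t f).snd = 0 :=
  mem_orthogonal_range_weightedGraph.1 (Submodule.starProjection_apply_mem _ _) g

/-- Inner products of `parallelSum A C t f` with vectors `w` orthogonal to all `(t A g, C g)`
involve only `A`. Estimates follow by choosing `w`. -/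
theorem inner_parallelSum {A : E →L[𝕜] H} {C : E →L[𝕜] K} {t : ℝ} {w : WithLp 2 (H × K)}
    (hw : ∀ f, (t : 𝕜) * inner 𝕜 (A f) w.fst + inner 𝕜 (C f) w.snd = 0) (f : E) :
    inner 𝕜 (parallelSum A C t f) w = t * inner 𝕜 (A f) w.fst := by
  have h1 := Submodule.starProjection_eq_self_iff.2 (mem_orthogonal_range_weightedGraph.2 hw)
  rw [parallelSum, comp_apply, Submodule.inner_starProjection_left_eq_right, h1,
    inner_weightedGraph, zero_apply, inner_zero_left, add_zero]

theorem norm_parallelSum_sq (A : E →L[𝕜] H) (C : E →L[𝕜] K) (t : ℝ) (f : E) :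
    ((‖parallelSum A C t f‖ : 𝕜) ^ 2) = t * inner 𝕜 (A f) (parallelSum A C t f).fst := by
  rw [← inner_parallelSum (inner_weightedGraph_parallelSum_eq_zero A C t f),
    inner_self_eq_norm_sq_to_K]

theorem norm_parallelSum_le (A : E →L[𝕜] H) (C : E →L[𝕜] K) {t : ℝ} (ht : 0 ≤ t) (f : E) :
    ‖parallelSum A C t f‖ ≤ t * ‖A f‖ := by
  refine (Submodule.norm_starProjection_apply_le _ _).trans (le_of_eq ?_)
  have : ‖weightedGraph A (0 : E →L[𝕜] K) t f‖ = ‖(t : 𝕜) • A f‖ :=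
    WithLp.norm_toLp_fst 2 H K _
  exact this.trans (by rw [norm_smul, RCLike.norm_ofReal, abs_of_nonneg ht])

/-- The infimum defining the parallel sum is at most its value `‖C f‖²` at `g = f`. -/
theorem norm_parallelSum_le_norm (A : E →L[𝕜] H) (C : E →L[𝕜] K) (t : ℝ) (f : E) :
    ‖parallelSum A C t f‖ ≤ ‖C f‖ := by
  set w := parallelSum A C t f with hw
  have h1 : ‖w‖ ^ 2 ≤ ‖C f‖ * ‖w‖ := by
    have h2 : (‖w‖ : 𝕜) ^ 2 = - inner 𝕜 (C f) w.snd := by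
      rw [hw, norm_parallelSum_sq]
      exact eq_neg_of_add_eq_zero_left (inner_weightedGraph_parallelSum_eq_zero A C t f f)
    calc ‖w‖ ^ 2 = ‖(‖w‖ : 𝕜) ^ 2‖ := by simp
      _ = ‖inner 𝕜 (C f) w.snd‖ := by rw [h2, norm_neg]
      _ ≤ ‖C f‖ * ‖w.snd‖ := norm_inner_le_norm _ _
      _ ≤ ‖C f‖ * ‖w‖ := by gcongr; exact norm_snd_le w
  rcases (norm_nonneg w).eq_or_lt with h | h
  · rw [← h]; positivity
  · exact le_of_mul_le_mul_right (by rwa [← sq]) h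

theorem norm_parallelSum_mono (A : E →L[𝕜] H) (C : E →L[𝕜] K) {s t : ℝ} (hs : 0 ≤ s)
    (hst : s ≤ t) (ht : 0 < t) (f : E) :
    ‖parallelSum A C s f‖ ≤ ‖parallelSum A C t f‖ := by
  set w := parallelSum A C s f with hw
  -- Rescaling the first component of `w` turns it into a test vector for the parameter `t`.
  let w' : WithLp 2 (H × K) := WithLp.toLp 2 (((s / t : ℝ) : 𝕜) • w.fst, w.snd)
  have h1 : ∀ g, (t : 𝕜) * inner 𝕜 (A g) w'.fst = s * inner 𝕜 (A g) w.fst := fun g => by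
    change (t : 𝕜) * inner 𝕜 (A g) (((s / t : ℝ) : 𝕜) • w.fst) = _
    have : (t : 𝕜) ≠ 0 := by exact_mod_cast ht.ne'
    rw [inner_smul_right]
    push_cast
    field_simp
  have h2 : ‖w'‖ ≤ ‖w‖ := by
    refine (pow_le_pow_iff_left₀ (norm_nonneg _) (norm_nonneg _) two_ne_zero).1 ?_
    rw [WithLp.prod_norm_sq_eq_of_L2, WithLp.prod_norm_sq_eq_of_L2]
    change ‖((s / t : ℝ) : 𝕜) • w.fst‖ ^ 2 + ‖w.snd‖ ^ 2 ≤ _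
    have h3 : ‖((s / t : ℝ) : 𝕜) • w.fst‖ ≤ ‖w.fst‖ := by
      rw [norm_smul, RCLike.norm_ofReal, abs_of_nonneg (by positivity)]
      exact mul_le_of_le_one_left (norm_nonneg _) ((div_le_one ht).2 hst)
    gcongr
  have h4 : ‖w‖ ^ 2 ≤ ‖parallelSum A C t f‖ * ‖w‖ := by
    calc ‖w‖ ^ 2 = ‖(‖w‖ : 𝕜) ^ 2‖ := by simp
      _ = ‖inner 𝕜 (parallelSum A C t f) w'‖ := by
        rw [hw, norm_parallelSum_sq, inner_parallelSum (w := w'), h1]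
        intro g
        rw [h1]
        exact inner_weightedGraph_parallelSum_eq_zero A C s f g
      _ ≤ ‖parallelSum A C t f‖ * ‖w'‖ := norm_inner_le_norm _ _
      _ ≤ _ := by gcongr
  rcases (norm_nonneg w).eq_or_lt with h | h
  · rw [← h]; positivity
  · exact le_of_mul_le_mul_right (by rwa [← sq]) h

variable [CompleteSpace E]

/-- If `A* h = C* k`, then `(h / t, -k)` is orthogonal to the vectors `(t A g, C g)`, and testing
`parallelSum A C t f` against it bounds its norm from below. -/
theorem norm_inner_le_norm_parallelSum {A : E →L[𝕜] H} {C : E →L[𝕜] K} {t : ℝ} (ht : 0 < t)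
    {h : H} {k : K} (e : (A†) h = (C†) k) (f : E) :
    ‖inner 𝕜 (C f) k‖ ≤ ‖parallelSum A C t f‖ * (‖h‖ / t + ‖k‖) := by
  let w : WithLp 2 (H × K) := WithLp.toLp 2 (((t⁻¹ : ℝ) : 𝕜) • h, -k)
  have htk : (t : 𝕜) ≠ 0 := by exact_mod_cast ht.ne'
  have h1 : ∀ g, (t : 𝕜) * inner 𝕜 (A g) w.fst = inner 𝕜 (C g) k := fun g => by
    change (t : 𝕜) * inner 𝕜 (A g) (((t⁻¹ : ℝ) : 𝕜) • h) = _
    rw [inner_smul_right, ← adjoint_inner_right C, ← e, adjoint_inner_right]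
    push_cast
    field_simp
  have h2 : ‖w‖ ≤ ‖h‖ / t + ‖k‖ := by
    refine (pow_le_pow_iff_left₀ (norm_nonneg _) (by positivity) two_ne_zero).1 ?_
    rw [WithLp.prod_norm_sq_eq_of_L2]
    change ‖((t⁻¹ : ℝ) : 𝕜) • h‖ ^ 2 + ‖-k‖ ^ 2 ≤ _
    rw [norm_smul, RCLike.norm_ofReal, abs_of_pos (inv_pos.2 ht), norm_neg, inv_mul_eq_div]
    have : 0 ≤ ‖h‖ / t * ‖k‖ := by positivity
    nlinarith
  rw [← h1, ← inner_parallelSum]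
  · exact (norm_inner_le_norm _ _).trans (by gcongr)
  · intro g
    rw [h1]
    change inner 𝕜 (C g) k + inner 𝕜 (C g) (-k) = 0
    rw [inner_neg_right, add_neg_cancel]

theorem tendsto_norm_parallelSum {A : E →L[𝕜] H} {C : E →L[𝕜] K} (hD : (DD A C)ᗮ = ⊥) (f : E) :
    Tendsto (fun n : ℕ => ‖parallelSum A C (n + 1) f‖) atTop (𝓝 ‖C f‖) := by
  have hmono : Monotone (fun n : ℕ => ‖parallelSum A C (n + 1) f‖) := fun m n hmn =>
    norm_parallelSum_mono A C (by positivity) (by exact_mod_cast Nat.succ_le_succ hmn)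
      (by positivity) f
  have hbdd : BddAbove (Set.range fun n : ℕ => ‖parallelSum A C (n + 1) f‖) :=
    ⟨‖C f‖, by rintro _ ⟨n, rfl⟩; exact norm_parallelSum_le_norm A C _ f⟩
  have hlim := tendsto_atTop_ciSup hmono hbdd
  set l := ⨆ n : ℕ, ‖parallelSum A C (n + 1) f‖
  have hle : l ≤ ‖C f‖ := le_of_tendsto' hlim fun n => norm_parallelSum_le_norm A C _ f
  have hDD : ∀ k ∈ DD A C, ‖inner 𝕜 (C f) k‖ ≤ l * ‖k‖ := fun k hk => by
    obtain ⟨h, e⟩ := mem_DD.1 hk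
    have h1 : Tendsto (fun n : ℕ => ‖h‖ / ((n : ℝ) + 1) + ‖k‖) atTop (𝓝 (0 + ‖k‖)) := by
      refine Tendsto.add_const _ ?_
      simpa [div_eq_mul_inv] using tendsto_one_div_add_atTop_nhds_zero_nat.const_mul ‖h‖
    rw [zero_add] at h1
    exact ge_of_tendsto' (hlim.mul h1) fun n =>
      norm_inner_le_norm_parallelSum (by positivity) e f
  have hall : ∀ k, ‖inner 𝕜 (C f) k‖ ≤ l * ‖k‖ := fun k => by
    have hk : k ∈ closure (DD A C : Set K) := by
      rw [← Submodule.topologicalClosure_eq_top_iff] at hD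
      rw [← Submodule.topologicalClosure_coe, hD]
      trivial
    have hcl : IsClosed {k : K | ‖inner 𝕜 (C f) k‖ ≤ l * ‖k‖} :=
      isClosed_le (by fun_prop) (by fun_prop)
    exact closure_minimal hDD hcl hk
  have h2 : ‖C f‖ ≤ l := by
    have := hall (C f)
    rw [inner_self_eq_norm_sq_to_K, norm_pow, norm_algebraMap', norm_norm, sq] at this
    rcases (norm_nonneg (C f)).eq_or_lt with h | h
    · rw [← h]
      exact ge_of_tendsto' hlim fun n => norm_nonneg _
    · exact le_of_mul_le_mul_right this h
  rwa [le_antisymm hle h2] at hlim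

/-- `C` is almost dominated by `A` if and only if `L(A,C)` is regular, that is, `𝔇(A,C)` is
dense. -/
theorem almostDominated_iff {A : E →L[𝕜] H} {C : E →L[𝕜] K} :
    AlmostDominated A C ↔ (DD A C)ᗮ = ⊥ := by
  refine ⟨fun h => isRegular_L_iff.1 h.isRegular_L, fun hD => ?_⟩
  -- The summand `E` only serves to place the approximants in the universe of the definition.
  let J (S : E →L[𝕜] WithLp 2 (H × K)) : E →L[𝕜] WithLp 2 (E × WithLp 2 (H × K)) :=
    ((WithLp.prodContinuousLinearEquiv 2 𝕜 E (WithLp 2 (H × K))).symm :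
      E × WithLp 2 (H × K) →L[𝕜] WithLp 2 (E × WithLp 2 (H × K))) ∘L ((0 : E →L[𝕜] E).prod S)
  have hJ : ∀ S f, ‖J S f‖ = ‖S f‖ := fun S f =>
    WithLp.norm_toLp_snd 2 E (WithLp 2 (H × K)) _
  refine ⟨fun _ => WithLp 2 (E × WithLp 2 (H × K)), fun _ => inferInstance,
    fun _ => inferInstance, fun _ => inferInstance, fun n => J (parallelSum A C (n + 1)),
    fun n => n + 1, fun n => by positivity, fun f n => ?_, fun f n => ?_, fun f => ?_⟩
  · rw [hJ]
    exact norm_parallelSum_le A C (by positivity) f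
  · rw [hJ, hJ]
    exact norm_parallelSum_mono A C (by positivity) (by push_cast; linarith) (by positivity) f
  · simp only [hJ]
    exact tendsto_norm_parallelSum hD f

end AlmostDomination

/-! ### Lebesgue type decompositions of pairs -/

section Decompositions

variable {𝕜 : Type*} [RCLike 𝕜]
  {E : Type u} [NormedAddCommGroup E] [InnerProductSpace 𝕜 E] [CompleteSpace E]
  {H : Type v} [NormedAddCommGroup H] [InnerProductSpace 𝕜 H] [CompleteSpace H]
  {K : Type w} [NormedAddCommGroup K] [InnerProductSpace 𝕜 K] [CompleteSpace K]

/-- The decompositions of a pair are described by regularity and singularity of the relations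
induced by the components. -/
theorem isLebesgueTypeDecomposition_iff {A : E →L[𝕜] H} {B B₁ B₂ : E →L[𝕜] K} :
    IsLebesgueTypeDecomposition A B B₁ B₂ ↔ B = B₁ + B₂ ∧ (∀ f g, inner 𝕜 (B₁ f) (B₂ g) = 0) ∧
      Relation.IsRegular (L A B₁) ∧ Relation.IsSingular (L A B₂) := by
  have ho : (∀ f g, inner 𝕜 (B₁ f) (B₂ g) = 0) ↔ Submodule.IsOrtho
      (LinearMap.range (B₁ : E →ₗ[𝕜] K)) (LinearMap.range (B₂ : E →ₗ[𝕜] K)) := by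
    simp [Submodule.isOrtho_iff_inner_eq]
  rw [ho, isRegular_L_iff, isSingular_L_iff, ← almostDominated_iff, ← singular_iff]
  exact ⟨fun h => ⟨h.1, h.2, h.3, h.4⟩, fun h => ⟨h.1, h.2.1, h.2.2.1, h.2.2.2⟩⟩

theorem adjoint_comp_starProjection (U : Submodule 𝕜 K) [U.HasOrthogonalProjection]
    (B : E →L[𝕜] K) (k : K) : ((U.starProjection ∘L B)†) k = (B†) (U.starProjection k) := by
  rw [adjoint_comp, (isSelfAdjoint_starProjection U).adjoint_eq, comp_apply]

theorem adjoint_id_sub_starProjection_comp (U : Submodule 𝕜 K) [U.HasOrthogonalProjection]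
    (B : E →L[𝕜] K) (k : K) :
    (((ContinuousLinearMap.id 𝕜 K - U.starProjection) ∘L B)†) k =
      (B†) (k - U.starProjection k) := by
  rw [adjoint_comp, map_sub, (isSelfAdjoint_starProjection U).adjoint_eq, adjoint_id]
  simp

/-- Splitting `B` along a closed subspace `U` and its complement yields a Lebesgue type
decomposition when `U` meets `𝔇(A,B)` trivially and `𝔇(A,B) ⊓ Uᗮ` is dense in `Uᗮ`. -/
theorem isLebesgueTypeDecomposition_of_projection {A : E →L[𝕜] H} {B : E →L[𝕜] K}
    (U : Submodule 𝕜 K) [U.HasOrthogonalProjection]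
    (hreg : ∀ y ∈ Uᗮ, (∀ d ∈ DD A B, d ∈ Uᗮ → inner 𝕜 d y = 0) → y = 0)
    (hsing : ∀ u ∈ U, u ∈ DD A B → u = 0) :
    IsLebesgueTypeDecomposition A B ((ContinuousLinearMap.id 𝕜 K - U.starProjection) ∘L B)
      (U.starProjection ∘L B) := by
  rw [isLebesgueTypeDecomposition_iff]
  refine ⟨?_, fun f g => ?_, ?_, ?_⟩
  · ext f
    simp
  · exact Submodule.starProjection_inner_eq_zero _ _ (Submodule.starProjection_apply_mem _ _)
  · rw [isRegular_L_iff, Submodule.eq_bot_iff]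
    intro y hy
    rw [Submodule.mem_orthogonal] at hy
    have hyU : y ∈ Uᗮ := (Submodule.mem_orthogonal _ _).2 fun u hu => by
      refine hy u (mem_DD.2 ⟨0, ?_⟩)
      rw [adjoint_id_sub_starProjection_comp, Submodule.starProjection_eq_self_iff.2 hu]
      simp
    refine hreg y hyU fun d hd hdU => hy d ?_
    obtain ⟨h, e⟩ := mem_DD.1 hd
    refine mem_DD.2 ⟨h, ?_⟩
    rw [adjoint_id_sub_starProjection_comp, (Submodule.starProjection_apply_eq_zero_iff _).2 hdU,
      sub_zero, e]
  · rw [isSingular_L_iff]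
    intro h k e
    rw [adjoint_comp_starProjection] at e ⊢
    rw [hsing _ (Submodule.starProjection_apply_mem _ _) (mem_DD.2 ⟨h, e⟩), map_zero]

/-- `B = B_reg + B_sing` is always a Lebesgue type decomposition. -/
theorem isLebesgueTypeDecomposition_regPart_singPart (A : E →L[𝕜] H) (B : E →L[𝕜] K) :
    IsLebesgueTypeDecomposition A B (regPart A B) (singPart A B) := by
  refine isLebesgueTypeDecomposition_of_projection (DD A B)ᗮ (fun y hy h => ?_) fun u hu hu' => ?_
  · have : y ∈ (DD A B)ᗮ := (Submodule.mem_orthogonal _ _).2 fun d hd =>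
      h d hd (Submodule.le_orthogonal_orthogonal _ hd)
    exact inner_self_eq_zero.1 ((Submodule.mem_orthogonal _ _).1 hy y this)
  · exact inner_self_eq_zero.1 ((Submodule.mem_orthogonal _ _).1 hu u hu')

/-- Let `R` project onto `(ran B₂)ᗮ`. Then `B* R = B₁*`, so regularity of `B₁` forces `R` to vanish
on `𝔇(A,B)ᗮ`. If `𝔇(A,B)` is closed, then `R` leaves it invariant, and singularity of `B₂` forces
`B₂*` to vanish there. Hence `B₂* = B* P`, where `P` projects onto `𝔇(A,B)ᗮ`. -/
theorem eq_singPart_of_isClosed {A : E →L[𝕜] H} {B B₁ B₂ : E →L[𝕜] K}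
    (hcl : IsClosed (DD A B : Set K)) (h : IsLebesgueTypeDecomposition A B B₁ B₂) :
    B₂ = singPart A B := by
  obtain ⟨hB, ho, hr, hs⟩ := isLebesgueTypeDecomposition_iff.1 h
  rw [isRegular_L_iff] at hr
  rw [isSingular_L_iff] at hs
  set V := LinearMap.range (B₂ : E →ₗ[𝕜] K) with hV
  set R := Vᗮ.starProjection with hR
  have hB2 : ∀ k ∈ Vᗮ, (B₂†) k = 0 := fun k hk => ext_inner_right 𝕜 fun f => by
    rw [adjoint_inner_left, inner_zero_left]
    exact (Submodule.mem_orthogonal' _ _).1 hk _ ⟨f, rfl⟩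
  have hB1 : ∀ k ∈ Vᗮᗮ, (B₁†) k = 0 := fun k hk => ext_inner_right 𝕜 fun f => by
    rw [adjoint_inner_left, inner_zero_left]
    refine (Submodule.mem_orthogonal' _ _).1 hk _ ((Submodule.mem_orthogonal' _ _).2 ?_)
    rintro _ ⟨g, rfl⟩
    exact ho f g
  have hsum : ∀ k, (B†) k = (B₁†) k + (B₂†) k := fun k => by rw [hB, map_add, add_apply]
  have hRmem : ∀ k, R k ∈ Vᗮ := fun k => Submodule.starProjection_apply_mem _ _
  have hRmem' : ∀ k, k - R k ∈ Vᗮᗮ := fun k => Submodule.sub_starProjection_mem_orthogonal _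
  have hBR : ∀ k, (B†) (R k) = (B₁†) k := fun k => by
    have := hB1 _ (hRmem' k)
    rw [map_sub, sub_eq_zero] at this
    rw [hsum, hB2 _ (hRmem k), add_zero, this]
  have hRsymm : ∀ x y, inner 𝕜 (R x) y = inner 𝕜 x (R y) :=
    Submodule.inner_starProjection_left_eq_right _
  have hRz : ∀ z ∈ (DD A B)ᗮ, R z = 0 := fun z hz => by
    have : R z ∈ (DD A B₁)ᗮ := (Submodule.mem_orthogonal _ _).2 fun d hd => by
      obtain ⟨g, e⟩ := mem_DD.1 hd
      rw [← hRsymm]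
      exact (Submodule.mem_orthogonal _ _).1 hz _ (mem_DD.2 ⟨g, by rw [hBR, e]⟩)
    rwa [hr, Submodule.mem_bot] at this
  have hDD : (DD A B)ᗮᗮ = DD A B := by
    rw [Submodule.orthogonal_orthogonal_eq_closure, hcl.submodule_topologicalClosure_eq]
  have hd : ∀ d ∈ DD A B, (B₂†) d = 0 := fun d hd => by
    have hRd : R d ∈ DD A B := by
      rw [← hDD]
      refine (Submodule.mem_orthogonal _ _).2 fun z hz => ?_
      rw [← hRsymm, hRz z hz, inner_zero_left]
    obtain ⟨g, e⟩ := mem_DD.1 ((DD A B).sub_mem hd hRd)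
    rw [map_sub, hBR, hsum, add_sub_cancel_left] at e
    exact hs g d e
  have key : B₂† = (singPart A B)† := by
    ext k
    rw [singPart, adjoint_comp_starProjection]
    set z := (DD A B)ᗮ.starProjection k
    have hz : z ∈ (DD A B)ᗮ := Submodule.starProjection_apply_mem _ _
    have hkz : k - z ∈ DD A B := by
      rw [← hDD]
      exact Submodule.sub_starProjection_mem_orthogonal _
    have h1 := hd _ hkz
    rw [map_sub, sub_eq_zero] at h1
    rw [h1, hsum, ← hBR, hRz z hz, map_zero, zero_add]
  rw [← ContinuousLinearMap.adjoint_adjoint B₂, key, ContinuousLinearMap.adjoint_adjoint]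

theorem existsUnique_of_isClosed {A : E →L[𝕜] H} {B : E →L[𝕜] K}
    (hcl : IsClosed (DD A B : Set K)) :
    ∃! p : (E →L[𝕜] K) × (E →L[𝕜] K), IsLebesgueTypeDecomposition A B p.1 p.2 := by
  refine ⟨(regPart A B, singPart A B), isLebesgueTypeDecomposition_regPart_singPart A B, ?_⟩
  rintro ⟨B₁, B₂⟩ h
  have h2 := eq_singPart_of_isClosed hcl h
  have h1 : B₁ + B₂ = regPart A B + singPart A B :=
    h.eq_add.symm.trans (isLebesgueTypeDecomposition_regPart_singPart A B).eq_add
  dsimp only at h1 h2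
  rw [h2] at h1
  exact Prod.ext (add_right_cancel h1) h2

/-- If `𝔇(A,B)` is not closed, enlarging `𝔇(A,B)ᗮ` by a vector of the closure of `𝔇(A,B)` outside
`𝔇(A,B)` gives a Lebesgue type decomposition with a larger singular part. -/
theorem isClosed_of_existsUnique {A : E →L[𝕜] H} {B : E →L[𝕜] K}
    (hu : ∃! p : (E →L[𝕜] K) × (E →L[𝕜] K), IsLebesgueTypeDecomposition A B p.1 p.2) :
    IsClosed (DD A B : Set K) := by
  suffices hle : (DD A B)ᗮᗮ ≤ DD A B by
    rw [le_antisymm (Submodule.le_orthogonal_orthogonal _) hle]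
    exact Submodule.isClosed_orthogonal _
  intro k hk
  by_contra hkD
  have hk0 : k ≠ 0 := fun h => hkD (h ▸ Submodule.zero_mem _)
  have hkk : inner 𝕜 k k ≠ 0 := inner_self_eq_zero.not.2 hk0
  set N := (DD A B)ᗮ ⊔ Submodule.span 𝕜 {k} with hN
  have hmem : ∀ y, y ∈ Nᗮ ↔ y ∈ (DD A B)ᗮᗮ ∧ inner 𝕜 k y = 0 := fun y => by
    rw [hN, ← Submodule.inf_orthogonal, Submodule.mem_inf,
      Submodule.mem_orthogonal_singleton_iff_inner_right]
  have hzero : ∀ y, y ∈ (DD A B)ᗮ → y ∈ (DD A B)ᗮᗮ → y = 0 := fun y h1 h2 =>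
    inner_self_eq_zero.1 ((Submodule.mem_orthogonal _ _).1 h2 y h1)
  have hdec := isLebesgueTypeDecomposition_of_projection (A := A) (B := B) Nᗮᗮ ?_ ?_
  · have h1 := congrArg Prod.snd (hu.unique (y₁ := (_, _)) (y₂ := (_, _)) hdec
      (isLebesgueTypeDecomposition_regPart_singPart A B))
    have h2 : (Nᗮᗮ.starProjection ∘L B)† = (singPart A B)† := congrArg _ h1
    have h3 := DFunLike.congr_fun h2 k
    have hkN : k ∈ Nᗮᗮ := Submodule.le_orthogonal_orthogonal _
      (Submodule.mem_sup_right (Submodule.mem_span_singleton_self k))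
    rw [singPart, adjoint_comp_starProjection, adjoint_comp_starProjection,
      Submodule.starProjection_eq_self_iff.2 hkN,
      (Submodule.starProjection_apply_eq_zero_iff _).2 hk, map_zero] at h3
    exact hkD (mem_DD.2 ⟨0, by rw [h3, map_zero]⟩)
  · intro y hy hyd
    rw [Submodule.triorthogonal_eq_orthogonal, hmem] at hy
    obtain ⟨d₀, hd₀, hkd₀⟩ : ∃ d ∈ DD A B, inner 𝕜 k d ≠ 0 := by
      by_contra! h
      exact hk0 (hzero k ((Submodule.mem_orthogonal' _ _).2 h) hk)
    -- Correcting `d ∈ 𝔇(A,B)` by a multiple of `d₀` makes it orthogonal to `k`; hence `y` is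
    -- orthogonal to `𝔇(A,B)` up to a multiple of `k`.
    set c : 𝕜 := inner 𝕜 d₀ y / inner 𝕜 d₀ k
    have hd₀k : inner 𝕜 d₀ k ≠ 0 := fun h => hkd₀ (inner_eq_zero_symm.1 h)
    have hyc : y - c • k ∈ (DD A B)ᗮ := (Submodule.mem_orthogonal _ _).2 fun d hd => by
      set a : 𝕜 := inner 𝕜 k d / inner 𝕜 k d₀ with ha
      have hda : d - a • d₀ ∈ DD A B := Submodule.sub_mem _ hd (Submodule.smul_mem _ _ hd₀)
      have h1 := hyd _ hda (by
        rw [Submodule.triorthogonal_eq_orthogonal, hmem]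
        refine ⟨Submodule.le_orthogonal_orthogonal _ hda, ?_⟩
        rw [inner_sub_right, inner_smul_right, ha, div_mul_cancel₀ _ hkd₀, sub_self])
      rw [inner_sub_left, inner_smul_left, ha, map_div₀, inner_conj_symm, inner_conj_symm] at h1
      rw [inner_sub_right, inner_smul_right]
      rw [← h1]
      simp only [c]
      ring
    have hyc0 := sub_eq_zero.1 (hzero _ hyc
      (Submodule.sub_mem _ hy.1 (Submodule.smul_mem _ _ hk)))
    have h2 := hy.2
    rw [hyc0, inner_smul_right] at h2
    rw [hyc0, (mul_eq_zero.1 h2).resolve_right hkk, zero_smul]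
  · intro u hu' huD
    set c : 𝕜 := inner 𝕜 k u / inner 𝕜 k k
    have hkc : inner 𝕜 k (u - c • k) = 0 := by
      rw [inner_sub_right, inner_smul_right, div_mul_cancel₀ _ hkk, sub_self]
    have hucN : u - c • k ∈ Nᗮ := (hmem _).2
      ⟨Submodule.sub_mem _ (Submodule.le_orthogonal_orthogonal _ huD) (Submodule.smul_mem _ _ hk),
        hkc⟩
    have h1 : inner 𝕜 (u - c • k) (u - c • k) = 0 := by
      rw [inner_sub_left (𝕜 := 𝕜) u, inner_smul_left, hkc, mul_zero, sub_zero]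
      exact (Submodule.mem_orthogonal' _ _).1 hu' _ hucN
    have h2 : u = c • k := sub_eq_zero.1 (inner_self_eq_zero.1 h1)
    by_cases hc : c = 0
    · rw [h2, hc, zero_smul]
    · refine absurd ?_ hkD
      rw [h2] at huD
      exact (Submodule.smul_mem_iff _ hc).1 huD

theorem isClosed_DD_iff_dominated_regPart {A : E →L[𝕜] H} {B : E →L[𝕜] K} :
    IsClosed (DD A B : Set K) ↔ Dominated A (regPart A B) := by
  constructor
  · intro hcl
    refine dominated_of_forall_exists_adjoint_eq fun k => ?_
    rw [regPart, adjoint_id_sub_starProjection_comp, ← mem_DD]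
    have : k - (DD A B)ᗮ.starProjection k ∈ (DD A B)ᗮᗮ :=
      Submodule.sub_starProjection_mem_orthogonal _
    rwa [Submodule.orthogonal_orthogonal_eq_closure, hcl.submodule_topologicalClosure_eq] at this
  · intro hd
    suffices hle : (DD A B)ᗮᗮ ≤ DD A B by
      rw [le_antisymm (Submodule.le_orthogonal_orthogonal _) hle]
      exact Submodule.isClosed_orthogonal _
    intro k hk
    obtain ⟨g, e⟩ := hd.exists_adjoint_eq k
    rw [regPart, adjoint_id_sub_starProjection_comp,
      (Submodule.starProjection_apply_eq_zero_iff _).2 hk, sub_zero] at e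
    exact mem_DD.2 ⟨g, e⟩

end Decompositions

/-! ### Lebesgue type decompositions of `L(A,B)` -/

section RelationDecompositions

variable {𝕜 : Type*} [RCLike 𝕜]
  {E : Type u} [NormedAddCommGroup E] [InnerProductSpace 𝕜 E]
  {H : Type v} [NormedAddCommGroup H] [InnerProductSpace 𝕜 H]
  {K : Type w} [NormedAddCommGroup K] [InnerProductSpace 𝕜 K]

theorem Relation.IsRegular.eq_of_mem {T : Relation 𝕜 H K} (hT : Relation.IsRegular T) {x : H}
    {y z : K} (hy : (x, y) ∈ T) (hz : (x, z) ∈ T) : y = z := by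
  refine sub_eq_zero.1 (hT _ (Submodule.le_topologicalClosure _ ?_))
  simpa using T.sub_mem hy hz

theorem eq_of_L_eq_of_isRegular {A : E →L[𝕜] H} {C C' : E →L[𝕜] K}
    (hr : Relation.IsRegular (L A C)) (h : L A C = L A C') : C = C' := by
  ext f
  exact hr.eq_of_mem (mk_mem_L A C f) (h ▸ mk_mem_L A C' f)

/-- The regular component of a decomposition of `L(A,B)` has the form `L(A,B₁)`: as the components
have orthogonal ranges, `‖B₁ f‖ ≤ ‖B f‖`, so `B₁` is bounded. -/
theorem exists_clm_of_relation_decomposition {A : E →L[𝕜] H} {B : E →L[𝕜] K}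
    {T₁ T₂ : Relation 𝕜 H K} (h : Relation.IsLebesgueTypeDecomposition (L A B) T₁ T₂) :
    ∃ B₁ : E →L[𝕜] K, ∀ f, (A f, B₁ f) ∈ T₁ ∧ (A f, (B - B₁) f) ∈ T₂ := by
  have hex : ∀ f, ∃ y, (A f, y) ∈ T₁ ∧ (A f, B f - y) ∈ T₂ := fun f => by
    have h1 := mk_mem_L A B f
    rw [h.eq_sum] at h1
    obtain ⟨y₁, y₂, hy₁, hy₂, e⟩ := h1
    dsimp only at hy₁ hy₂ e
    exact ⟨y₁, hy₁, by rwa [e, add_sub_cancel_left]⟩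
  choose F hF₁ hF₂ using hex
  have hbound : ∀ f, ‖F f‖ ≤ ‖B‖ * ‖f‖ := fun f => by
    refine le_trans ?_ (B.le_opNorm f)
    have ho : inner 𝕜 (F f) (B f - F f) = 0 := Submodule.isOrtho_iff_inner_eq.1 h.ran_ortho _
      ⟨_, hF₁ f, rfl⟩ _ ⟨_, hF₂ f, rfl⟩
    have := norm_add_sq_eq_norm_sq_add_norm_sq_of_inner_eq_zero _ _ ho
    rw [add_sub_cancel] at this
    refine (pow_le_pow_iff_left₀ (norm_nonneg _) (norm_nonneg _) two_ne_zero).1 ?_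
    nlinarith [sq_nonneg ‖B f - F f‖]
  refine ⟨LinearMap.mkContinuous
    { toFun := F
      map_add' := fun f g => h.regular.eq_of_mem (hF₁ (f + g)) (by
        rw [map_add]
        exact T₁.add_mem (hF₁ f) (hF₁ g))
      map_smul' := fun c f => h.regular.eq_of_mem (hF₁ (c • f)) (by
        rw [map_smul]
        exact T₁.smul_mem c (hF₁ f)) } ‖B‖ hbound, fun f => ⟨hF₁ f, hF₂ f⟩⟩

variable [CompleteSpace E] [CompleteSpace H] [CompleteSpace K]

/-- Lebesgue type decompositions of the relation `L(A,B)` are the relations induced by the Lebesgue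
type decompositions of `B` with respect to `A`. -/
theorem relation_isLebesgueTypeDecomposition_L_iff {A : E →L[𝕜] H} {B : E →L[𝕜] K}
    {T₁ T₂ : Relation 𝕜 H K} :
    Relation.IsLebesgueTypeDecomposition (L A B) T₁ T₂ ↔
      ∃ B₁ B₂, IsLebesgueTypeDecomposition A B B₁ B₂ ∧ L A B₁ = T₁ ∧ L A B₂ = T₂ := by
  constructor
  · intro h
    obtain ⟨B₁, hB₁⟩ := exists_clm_of_relation_decomposition h
    have hT₁ : L A B₁ = T₁ := by
      ext ⟨x, y⟩
      constructor
      · intro hxy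
        obtain ⟨f, rfl, rfl⟩ := mem_L.1 hxy
        exact (hB₁ f).1
      · intro hxy
        have hx : x ∈ Relation.dom T₁ := ⟨_, hxy, rfl⟩
        rw [h.dom_left, mem_dom_L] at hx
        obtain ⟨f, rfl⟩ := hx
        rw [h.regular.eq_of_mem hxy (hB₁ f).1]
        exact mk_mem_L A B₁ f
    have hT₂ : L A (B - B₁) = T₂ := by
      ext ⟨x, y⟩
      constructor
      · intro hxy
        obtain ⟨f, rfl, rfl⟩ := mem_L.1 hxy
        exact (hB₁ f).2
      · intro hxy
        have hx : x ∈ Relation.dom T₂ := ⟨_, hxy, rfl⟩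
        rw [h.dom_right, mem_dom_L] at hx
        obtain ⟨f, rfl⟩ := hx
        -- `B₁ f + y = B g` for some `g` with `A g = A f`, and then `B₁ g = B₁ f`.
        have h1 : (A f, B₁ f + y) ∈ L A B := by
          rw [h.eq_sum]
          exact ⟨_, _, (hB₁ f).1, hxy, rfl⟩
        obtain ⟨g, hgA, hgB⟩ := mem_L.1 h1
        have h2 := (hB₁ g).1
        rw [hgA] at h2
        have h3 := h.regular.eq_of_mem h2 (hB₁ f).1
        exact mem_L.2 ⟨g, hgA, by rw [sub_apply, hgB, h3, add_sub_cancel_left]⟩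
    refine ⟨B₁, B - B₁, isLebesgueTypeDecomposition_iff.2 ⟨by abel, fun f g => ?_, ?_, ?_⟩,
      hT₁, hT₂⟩
    · exact Submodule.isOrtho_iff_inner_eq.1 h.ran_ortho _ ⟨_, (hB₁ f).1, rfl⟩ _
        ⟨_, (hB₁ g).2, rfl⟩
    · rw [hT₁]
      exact h.regular
    · rw [hT₂]
      exact h.singular
  · rintro ⟨B₁, B₂, h, rfl, rfl⟩
    obtain ⟨hB, ho, hr, hs⟩ := isLebesgueTypeDecomposition_iff.1 h
    refine ⟨?_, ?_, ?_, ?_, hr, hs⟩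
    · ext ⟨x, y⟩
      constructor
      · intro hxy
        obtain ⟨f, rfl, rfl⟩ := mem_L.1 hxy
        exact ⟨_, _, mk_mem_L A B₁ f, mk_mem_L A B₂ f, by rw [hB]; rfl⟩
      · rintro ⟨y₁, y₂, h₁, h₂, e⟩
        obtain ⟨g, hgA, hgB⟩ := mem_L.1 h₂
        dsimp only at h₁ hgA e
        have h3 := hr.eq_of_mem h₁ (hgA ▸ mk_mem_L A B₁ g)
        exact mem_L.2 ⟨g, hgA, by rw [hB, add_apply, hgB, e, h3]⟩
    · ext x
      rw [mem_dom_L, mem_dom_L]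
    · ext x
      rw [mem_dom_L, mem_dom_L]
    · rw [Submodule.isOrtho_iff_inner_eq]
      intro a ha b hb
      obtain ⟨f, rfl⟩ := mem_ran_L.1 ha
      obtain ⟨g, rfl⟩ := mem_ran_L.1 hb
      exact ho f g

theorem existsUnique_decomposition_iff_relation {A : E →L[𝕜] H} {B : E →L[𝕜] K} :
    (∃! p : (E →L[𝕜] K) × (E →L[𝕜] K), IsLebesgueTypeDecomposition A B p.1 p.2) ↔
      ∃! p : Relation 𝕜 H K × Relation 𝕜 H K,
        Relation.IsLebesgueTypeDecomposition (L A B) p.1 p.2 := by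
  constructor
  · rintro ⟨⟨B₁, B₂⟩, h, huniq⟩
    refine ⟨(L A B₁, L A B₂), relation_isLebesgueTypeDecomposition_L_iff.2
      ⟨B₁, B₂, h, rfl, rfl⟩, ?_⟩
    rintro ⟨T₁, T₂⟩ hT
    obtain ⟨C₁, C₂, hC, h₁, h₂⟩ := relation_isLebesgueTypeDecomposition_L_iff.1 hT
    obtain ⟨rfl, rfl⟩ := Prod.mk.inj (huniq (C₁, C₂) hC)
    exact Prod.ext h₁.symm h₂.symm
  · rintro ⟨⟨T₁, T₂⟩, hT, huniq⟩
    obtain ⟨B₁, B₂, h, h₁, -⟩ := relation_isLebesgueTypeDecomposition_L_iff.1 hT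
    refine ⟨(B₁, B₂), h, ?_⟩
    rintro ⟨C₁, C₂⟩ hC
    have h3 := huniq (L A C₁, L A C₂) (relation_isLebesgueTypeDecomposition_L_iff.2
      ⟨C₁, C₂, hC, rfl, rfl⟩)
    have h4 : L A C₁ = L A B₁ := (congrArg Prod.fst h3).trans h₁.symm
    have h5 : C₁ = B₁ := eq_of_L_eq_of_isRegular (isLebesgueTypeDecomposition_iff.1 hC).2.2.1 h4
    have h6 : C₁ + C₂ = B₁ + B₂ := hC.eq_add.symm.trans h.eq_add
    rw [h5] at h6
    exact Prod.ext h5 (add_left_cancel h6)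

end RelationDecompositions

end LebesgueType

theorem corollary8p4 {𝕜 : Type*} [RCLike 𝕜]
    {E : Type*} [NormedAddCommGroup E] [InnerProductSpace 𝕜 E] [CompleteSpace E]
    {H : Type*} [NormedAddCommGroup H] [InnerProductSpace 𝕜 H] [CompleteSpace H]
    {K : Type*} [NormedAddCommGroup K] [InnerProductSpace 𝕜 K] [CompleteSpace K]
    (A : E →L[𝕜] H) (B : E →L[𝕜] K) :
    List.TFAE [
      ∃! p : (E →L[𝕜] K) × (E →L[𝕜] K), LebesgueType.IsLebesgueTypeDecomposition A B p.1 p.2,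
      ∃! p : LebesgueType.Relation 𝕜 H K × LebesgueType.Relation 𝕜 H K,
        LebesgueType.Relation.IsLebesgueTypeDecomposition (LebesgueType.L A B) p.1 p.2,
      IsClosed (LebesgueType.DD A B : Set K),
      LebesgueType.Dominated A (LebesgueType.regPart A B),
      LebesgueType.Relation.IsBoundedOperator
        (LebesgueType.radonNikodym A (LebesgueType.regPart A B))] ∧
    ((∃! p : (E →L[𝕜] K) × (E →L[𝕜] K), LebesgueType.IsLebesgueTypeDecomposition A B p.1 p.2) →
      ∀ B₁ B₂ : E →L[𝕜] K, LebesgueType.IsLebesgueTypeDecomposition A B B₁ B₂ ↔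
        B₁ = LebesgueType.regPart A B ∧ B₂ = LebesgueType.singPart A B) := by
  have h13 := Iff.intro (LebesgueType.isClosed_of_existsUnique (A := A) (B := B))
    LebesgueType.existsUnique_of_isClosed
  have h12 := LebesgueType.existsUnique_decomposition_iff_relation (A := A) (B := B)
  have h34 := LebesgueType.isClosed_DD_iff_dominated_regPart (A := A) (B := B)
  have h45 := LebesgueType.dominated_iff_isBoundedOperator_radonNikodym (A := A)
    (C := LebesgueType.regPart A B)
  refine ⟨?_, fun hu B₁ B₂ => ⟨fun h => ?_, ?_⟩⟩
  · tfae_have 1 ↔ 2 := h12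
    tfae_have 1 ↔ 3 := h13
    tfae_have 3 ↔ 4 := h34
    tfae_have 4 ↔ 5 := h45
    tfae_finish
  · exact Prod.mk.inj (hu.unique (y₁ := (B₁, B₂)) (y₂ := (_, _)) h
      (LebesgueType.isLebesgueTypeDecomposition_regPart_singPart A B))
  · rintro ⟨rfl, rfl⟩
    exact LebesgueType.isLebesgueTypeDecomposition_regPart_singPart A B
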